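/- Let $Q$ be a smooth $n$-dimensional manifold (Hausdorff, second countable) and let $\Sigma=(Q,g,V,\mathcal F)$ be a simple mechanical control system: $g$ is a smooth Riemannian metric on $Q$, $V\in C^\infty(Q)$, and $\mathcal F\subseteq T^*Q$ is a smooth codistribution of rank $m$. A locally Lipschitz control force is a locally Lipschitz map $F:TQ\to\mathcal F$ with $F(v_q)\in\mathcal F_q$ for all $v_q\in T_qQ$; it gives the closed-loop system $$\nabla_{\dot q}\dot q=-\operatorname{grad}V(q)+F(\dot q)^\sharp,$$ where $\nabla$ is the Levi-Civita connection of $g$ and $\sharp:T^*Q\to TQ$ is the isomorphism given by $g$. For $v_q\in T_qQ$ and $F_q\in\mathcal F_q$, let $\Phi(v_q,F_q)\in T_{v_q}(TQ)$ be the vector describing the equation $\nabla_{\dot q}\dot q=-\operatorname{grad}V+F_q^\sharp$ on $TQ$, i.e. the unique vector $\xi$ that projects to $v_q$ under $d\pi_{TQ}$ and whose covariant vertical part is $-\operatorname{grad}V(q)+F_q^\sharp$. Let $\mathcal U_qQ=\{v\in T_qQ:\langle\varphi;v\rangle=0\ \ \forall\varphi\in\mathcal F_q\}$, let $\mathcal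 A_qQ=(\mathcal U_qQ)^\perp$ be its $g$-orthogonal complement, and write $v\mapsto v^{\mathcal A}$ for the $g$-orthogonal projection of $T_qQ$ onto $\mathcal A_qQ$. Let $h_0\in C^\infty(Q)$ have $0$ as a regular value, and put $\mathcal C_0=\{q\in Q:h_0(q)\ge 0\}$. Let $\alpha:\mathbb R\to\mathbb R$ be locally Lipschitz and strictly increasing, with $\alpha(0)=0$ and $\lim_{r\to\pm\infty}\alpha(r)=\pm\infty$. Let $\mathcal D_0\supseteq\mathcal C_0$ be open, and let $\kappa$ be a smooth vector field on $Q$ with $d(h_0)_q\kappa_q>-\alpha(h_0(q))$ for all $q\in\mathcal D_0$. Suppose that $\mathcal U_qQ\subseteq\ker d(h_0)_q$ for all $q\in\mathcal D_0$. For $\varepsilon>0$ define $$h(v_q)=h_0(q)-\tfrac{\varepsilon}{2}\,\|(v_q-\kappa_q)^{\mathcal A}\|^2\quad(v_q\in TQ),\qquad \dot h(v_q,F_q)=dh_{v_q}\Phi(v_q,F_q).$$ **Proposition.** Let $F$ be any locally Lipschitz control force with $\dot h(v_q,F(v_q))\ge-\alpha(h(v_q))$ for all $v_q\in T\mathcal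 D_0$ (that is, for all $v_q\in T_qQ$ with $q\in\mathcal D_0$). Let $\dot q_0\in TQ$ satisfy $h(\dot q_0)\ge 0$, and let $\dot q:J\to TQ$ be any trajectory of the closed-loop system (an integral curve of $v_q\mapsto\Phi(v_q,F(v_q))$) on an open interval $J\ni 0$ with $\dot q(0)=\dot q_0$; in particular $\dot q$ may be the maximal one. Then the base curve $q(t)=\pi_{TQ}(\dot q(t))$ satisfies $q(t)\in\mathcal C_0$ for all $t\in J$ with $t\ge 0$. -/

import Mathlib

open Set Filter Topology Bundle
open scoped Manifold ContDiff

noncomputable section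

namespace GeomCBF

/-- A function `α : ℝ → ℝ` of extended class `𝒦_∞`: continuous, strictly increasing, `α 0 = 0`,
and `α r → ±∞` as `r → ±∞`. -/
structure IsExtendedClassKInfty (α : ℝ → ℝ) : Prop where
  continuous : Continuous α
  strictMono : StrictMono α
  map_zero : α 0 = 0
  tendsto_atTop : Tendsto α atTop atTop
  tendsto_atBot : Tendsto α atBot atBot

/-- A map between manifolds is locally Lipschitz if it is continuous and its local representatives
in charts are Lipschitz near every point. -/
def IsLocallyLipschitz
    {E : Type*} [NormedAddCommGroup E] [NormedSpace ℝ E] {H : Type*} [TopologicalSpace H]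
    (I : ModelWithCorners ℝ E H) {M : Type*} [TopologicalSpace M] [ChartedSpace H M]
    {E' : Type*} [NormedAddCommGroup E'] [NormedSpace ℝ E'] {H' : Type*} [TopologicalSpace H']
    (I' : ModelWithCorners ℝ E' H') {M' : Type*} [TopologicalSpace M'] [ChartedSpace H' M']
    (f : M → M') : Prop :=
  Continuous f ∧ ∀ x : M, ∃ K : NNReal, ∃ s ∈ 𝓝[range I] (extChartAt I x x),
    LipschitzOnWith K (writtenInExtChartAt I I' x f) s

/-- The Christoffel symbols of the first kind of a metric `G` on an open set of a vector space:
`w ↦ ½ (∂_u G(v,w) + ∂_v G(u,w) - ∂_w G(u,v))`. -/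
def christoffelForm {E : Type*} [NormedAddCommGroup E] [NormedSpace ℝ E]
    (G : E → E →L[ℝ] E →L[ℝ] ℝ) (x u v : E) : E →L[ℝ] ℝ :=
  (1 / 2 : ℝ) • (fderiv ℝ G x u v + fderiv ℝ G x v u - ((fderiv ℝ G x).flip u).flip v)

/-- The model vector space of an `n`-dimensional manifold. -/
abbrev Model (n : ℕ) : Type := EuclideanSpace ℝ (Fin n)

section

variable {n : ℕ} {Q : Type*} [TopologicalSpace Q] [ChartedSpace (Model n) Q]
  [IsManifold (𝓡 n) ∞ Q]

/-- The tangent space `T_q Q`. -/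
abbrev Tan (n : ℕ) {Q : Type*} [TopologicalSpace Q] [ChartedSpace (Model n) Q] (q : Q) : Type :=
  TangentSpace (𝓡 n) q

/-- The cotangent space `T_q^* Q`. -/
abbrev Cotan (n : ℕ) {Q : Type*} [TopologicalSpace Q] [ChartedSpace (Model n) Q] (q : Q) : Type :=
  Tan n q →L[ℝ] ℝ

/-- Smooth Riemannian metrics on `Q`. -/
abbrev Metric (n : ℕ) (Q : Type*) [TopologicalSpace Q] [ChartedSpace (Model n) Q]
    [IsManifold (𝓡 n) ∞ Q] : Type _ :=
  ContMDiffRiemannianMetric (𝓡 n) ∞ (Model n) (fun q : Q => Tan n q)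

instance (q : Q) : FiniteDimensional ℝ (Tan n q) :=
  inferInstanceAs (FiniteDimensional ℝ (Model n))

/-- The inner product `⟨·,·⟩` on `T_q Q` as an algebraic bilinear form. -/
def metricForm (g : Metric n Q) (q : Q) : LinearMap.BilinForm ℝ (Tan n q) :=
  LinearMap.mk₂ ℝ (fun v w => g.inner q v w)
    (fun _ _ _ => by simp) (fun _ _ _ => by simp) (fun _ _ _ => by simp) (fun _ _ _ => by simp)

theorem metricForm_isSymm (g : Metric n Q) (q : Q) : (metricForm g q).IsSymm :=
  ⟨fun v w => g.symm q v w⟩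

theorem metricForm_nondegenerate (g : Metric n Q) (q : Q) : (metricForm g q).Nondegenerate := by
  refine (metricForm_isSymm g q).isRefl.nondegenerate_iff_separatingLeft.2 fun v hv => ?_
  by_contra h
  exact (g.pos q v h).ne' (hv v)

/-- The musical isomorphism `♯ : T_q^* Q → T_q Q`, so that `⟨η^♯, v⟩ = η v` for all `v`. -/
def sharp (g : Metric n Q) (q : Q) (η : Cotan n q) : Tan n q :=
  ((metricForm g q).toDual (metricForm_nondegenerate g q)).symm η.toLinearMap

theorem inner_sharp (g : Metric n Q) (q : Q) (η : Cotan n q) (v : Tan n q) :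
    g.inner q (sharp g q η) v = η v :=
  LinearMap.BilinForm.apply_toDual_symm_apply (hB := metricForm_nondegenerate g q)
    η.toLinearMap v

/-- The Riemannian gradient. -/
def grad (g : Metric n Q) (V : Q → ℝ) (q : Q) : Tan n q :=
  sharp g q (mvfderiv (𝓡 n) V q)

/-- The matrix `(g_ij)` of the metric in the preferred chart `φ` at `q`, at the point `x` of the
target of `φ`: the inner product `⟨d(φ⁻¹)_x u, d(φ⁻¹)_x w⟩`. -/
def metricInChart (g : Metric n Q) (q : Q) (x : Model n) : Model n →L[ℝ] Model n →L[ℝ] ℝ :=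
  let p : Q := (extChartAt (𝓡 n) q).symm x
  let G : Model n →L[ℝ] Model n →L[ℝ] ℝ := g.inner p
  let A : Model n →L[ℝ] Model n := mfderiv 𝓘(ℝ, Model n) (𝓡 n) (extChartAt (𝓡 n) q).symm x
  G.bilinearComp A A

/-- The Christoffel symbols of the first kind of the Levi-Civita connection at `q`, in the
preferred chart at `q`. The differential at `q` of the preferred chart at `q` is the identity of
`T_q Q`, which is `ℝⁿ` by definition. -/
def christoffelFirst (g : Metric n Q) (q : Q) (u v : Tan n q) : Cotan n q :=
  christoffelForm (E := Model n) (metricInChart g q) (extChartAt (𝓡 n) q q) u v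

/-- The Christoffel symbols `Γ(u,v) = Γ^k_ij u^i v^j` of the Levi-Civita connection at `q`, in the
preferred chart at `q`. -/
def christoffel (g : Metric n Q) (q : Q) (u v : Tan n q) : Tan n q :=
  sharp g q (christoffelFirst g q u v)

theorem mfderiv_proj (v : TangentBundle (𝓡 n) Q) (ξ : TangentSpace (𝓡 n).tangent v) :
    mfderiv (𝓡 n).tangent (𝓡 n) (TotalSpace.proj : TangentBundle (𝓡 n) Q → Q) v ξ =
      (show Model n × Model n from ξ).1 := by
  have h : HasMFDerivAt (𝓡 n).tangent (𝓡 n) (TotalSpace.proj : TangentBundle (𝓡 n) Q → Q) v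
      (ContinuousLinearMap.fst ℝ (Model n) (Model n)) := by
    refine ⟨(FiberBundle.continuous_proj (Model n) (fun q : Q => Tan n q)).continuousAt, ?_⟩
    have key : ∀ w : TangentBundle (𝓡 n) Q,
        w.proj ∈ (trivializationAt (Model n) (fun q : Q => Tan n q) v.proj).baseSet →
        extChartAt (𝓡 n) v.proj w.proj = (extChartAt (𝓡 n).tangent v w).1 := fun w hw => by
      rw [FiberBundle.extChartAt]
      show _ = extChartAt (𝓡 n) v.proj (trivializationAt (Model n) (fun q : Q => Tan n q) v.proj w).1
      rw [Trivialization.coe_fst' _ hw]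
    refine (hasFDerivAt_fst.hasFDerivWithinAt (s := range (𝓡 n).tangent)).congr_of_eventuallyEq
      (f := Prod.fst) ?_ ?_
    · filter_upwards [extChartAt_target_mem_nhdsWithin (I := (𝓡 n).tangent) v] with x hx
      have hs := (extChartAt (𝓡 n).tangent v).map_target hx
      have hr := (extChartAt (𝓡 n).tangent v).right_inv hx
      rw [FiberBundle.extChartAt] at hs
      refine (key _ ?_).trans (congrArg Prod.fst hr)
      exact (Trivialization.mem_source _).1 hs.1
    · refine (congrArg (fun w : TangentBundle (𝓡 n) Q => extChartAt (𝓡 n) v.proj w.proj)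
        (extChartAt_to_inv (I := (𝓡 n).tangent) v)).trans (key v ?_)
      exact mem_baseSet_trivializationAt _ _ _
  rw [h.mfderiv]
  rfl

/-- The connector of the Levi-Civita connection: if `X` is a curve in `TQ` over the curve `q`
with `X t = v` and `X'(t) = ξ ∈ T_v (TQ)`, then `∇_{q'} X (t) = connector g v ξ`. In the
coordinates `(x, ẋ)` of `TQ` induced by the preferred chart at the base point of `v`, in which
`T_v (TQ)` is identified with `ℝⁿ × ℝⁿ`, this is `ξ.2 + Γ(ξ.1, v)`. -/
def connector (g : Metric n Q) (v : TangentBundle (𝓡 n) Q)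
    (ξ : TangentSpace (𝓡 n).tangent v) : Tan n v.proj :=
  let ξ' : Model n × Model n := ξ
  (show Tan n v.proj from ξ'.2) + christoffel g v.proj (show Tan n v.proj from ξ'.1) v.snd

/-- A smooth rank `m` codistribution: a family of subspaces of the cotangent spaces which is
locally spanned by `m` smooth pointwise linearly independent covector fields. -/
def IsCodistribution (m : ℕ) (𝓕 : ∀ q : Q, Submodule ℝ (Cotan n q)) : Prop :=
  ∀ q₀ : Q, ∃ U : Set Q, IsOpen U ∧ q₀ ∈ U ∧ ∃ η : Fin m → ∀ q : Q, Cotan n q,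
    (∀ i, ContMDiffOn (𝓡 n) ((𝓡 n).prod 𝓘(ℝ, Model n →L[ℝ] ℝ)) ∞
      (fun q => TotalSpace.mk' (Model n →L[ℝ] ℝ) (E := fun q : Q => Cotan n q) q (η i q)) U) ∧
    ∀ q ∈ U, LinearIndependent ℝ (fun i => η i q) ∧
      Submodule.span ℝ (range fun i => η i q) = 𝓕 q

end

/-- A simple mechanical control system on the `n`-dimensional configuration manifold `Q`, with
`m`-dimensional input codistribution. -/
structure SMCS (n m : ℕ) (Q : Type*) [TopologicalSpace Q] [ChartedSpace (Model n) Q]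
    [IsManifold (𝓡 n) ∞ Q] where
  /-- the kinetic energy metric -/
  g : Metric n Q
  /-- the potential function -/
  V : Q → ℝ
  contMDiff_V : ContMDiff (𝓡 n) 𝓘(ℝ, ℝ) ∞ V
  /-- the input codistribution -/
  𝓕 : ∀ q : Q, Submodule ℝ (Cotan n q)
  isCodistribution : IsCodistribution m 𝓕

namespace SMCS

variable {n m : ℕ} {Q : Type*} [TopologicalSpace Q] [ChartedSpace (Model n) Q]
  [IsManifold (𝓡 n) ∞ Q] (S : SMCS n m Q)

/-- The unactuated distribution, the coannihilator of the input codistribution. -/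
def unactuated (q : Q) : Submodule ℝ (Tan n q) where
  carrier := {v | ∀ φ ∈ S.𝓕 q, φ v = 0}
  add_mem' := fun ha hb φ hφ => by rw [map_add, ha φ hφ, hb φ hφ, add_zero]
  zero_mem' := fun φ _ => map_zero φ
  smul_mem' := fun c v hv φ hφ => by rw [map_smul, hv φ hφ, smul_zero]

/-- The actuated distribution, the `g`-orthogonal complement of the unactuated one. -/
def actuated (q : Q) : Submodule ℝ (Tan n q) :=
  (metricForm S.g q).orthogonal (S.unactuated q)

theorem isCompl_actuated_unactuated (q : Q) : IsCompl (S.actuated q) (S.unactuated q) := by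
  refine (((metricForm S.g q).isCompl_orthogonal_iff_disjoint
    (metricForm_isSymm S.g q).isRefl).2 ?_).symm
  rw [Submodule.disjoint_def]
  intro v hv hv'
  by_contra h
  exact (S.g.pos q v h).ne' (hv' v hv)

/-- The projection `π_𝒜 : v ↦ v^𝒜` onto the actuated distribution along the unactuated one. -/
def actuatedProj (q : Q) : Tan n q →ₗ[ℝ] Tan n q :=
  (S.actuated q).projection (S.unactuated q) (S.isCompl_actuated_unactuated q)

/-- The dynamics `Φ(v_q, F_q) ∈ T_{v_q}(TQ)`: the lift to `TQ` of the equations of motion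
`∇_{q̇} q̇ = -grad V + F^♯`. -/
def dynamics (v : TangentBundle (𝓡 n) Q) (φ : Cotan n v.proj) :
    TangentSpace (𝓡 n).tangent v :=
  let a : Tan n v.proj :=
    -christoffel S.g v.proj v.snd v.snd + (-grad S.g S.V v.proj + sharp S.g v.proj φ)
  show Model n × Model n from (v.snd, a)

theorem eq_dynamics_iff (v : TangentBundle (𝓡 n) Q) (φ : Cotan n v.proj)
    (ξ : TangentSpace (𝓡 n).tangent v) :
    ξ = S.dynamics v φ ↔
      mfderiv (𝓡 n).tangent (𝓡 n) (TotalSpace.proj : TangentBundle (𝓡 n) Q → Q) v ξ = v.snd ∧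
      connector S.g v ξ = -grad S.g S.V v.proj + sharp S.g v.proj φ := by
  rw [mfderiv_proj]
  obtain ⟨a, b⟩ : Model n × Model n := ξ
  constructor
  · intro h
    obtain ⟨rfl, rfl⟩ := Prod.ext_iff.1 h
    exact ⟨rfl, by simp only [connector, dynamics]; abel⟩
  · rintro ⟨rfl, h⟩
    refine Prod.ext rfl ?_
    simp only [connector, dynamics] at h ⊢
    exact (eq_neg_add_iff_add_eq.2 ((add_comm _ _).trans h))

/-- A locally Lipschitz control force: a locally Lipschitz map `F : TQ → T^*Q` over the identity
of `Q`, with values in the input codistribution. -/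
structure IsControlForce (F : ∀ v : TangentBundle (𝓡 n) Q, Cotan n v.proj) : Prop where
  mem : ∀ v, F v ∈ S.𝓕 v.proj
  locallyLipschitz : IsLocallyLipschitz (𝓡 n).tangent ((𝓡 n).prod 𝓘(ℝ, Model n →L[ℝ] ℝ))
    (fun v : TangentBundle (𝓡 n) Q =>
      TotalSpace.mk' (Model n →L[ℝ] ℝ) (E := fun q : Q => Cotan n q) v.proj (F v))

/-- The candidate barrier function `h(v_q) = h₀(q) - (ε/2) ‖(v_q - κ_q)^𝒜‖²` on `TQ`. -/
def barrier (h₀ : Q → ℝ) (κ : ∀ q : Q, Tan n q) (ε : ℝ) (v : TangentBundle (𝓡 n) Q) : ℝ :=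
  let e : Tan n v.proj := S.actuatedProj v.proj (v.snd - κ v.proj)
  h₀ v.proj - ε / 2 * S.g.inner v.proj e e

/-- `ḣ(v_q, F_q) = dh_{v_q} Φ(v_q, F_q)`. -/
def hDot (h : TangentBundle (𝓡 n) Q → ℝ) (v : TangentBundle (𝓡 n) Q) (φ : Cotan n v.proj) : ℝ :=
  mvfderiv (𝓡 n).tangent h v (S.dynamics v φ)

/-- `γ` is a trajectory on the interval `J`, with initial velocity `v₀`, of the closed-loop system
with control force `F`: an integral curve in `TQ` of the vector field `v ↦ Φ(v, F v)`. -/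
structure IsTrajectory (F : ∀ v : TangentBundle (𝓡 n) Q, Cotan n v.proj)
    (v₀ : TangentBundle (𝓡 n) Q) (J : Set ℝ) (γ : ℝ → TangentBundle (𝓡 n) Q) : Prop where
  isOpen : IsOpen J
  ordConnected : J.OrdConnected
  zero_mem : (0 : ℝ) ∈ J
  initial : γ 0 = v₀
  isMIntegralCurveOn : IsMIntegralCurveOn (I := (𝓡 n).tangent) γ (fun v => S.dynamics v (F v)) J

end SMCS

end GeomCBF

end

/-!
The barrier function `h` satisfies `h ≤ h₀ ∘ π`, so it suffices that `h` stays nonnegative along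
the trajectory. Suppose that `h` is nonnegative at a time `s` and negative immediately afterwards.
At time `s` the base point lies in `C₀`, hence in the open set `D₀`, and it remains in `D₀` for a
short time. There the derivative of `h` along the trajectory is `ḣ ≥ -α(h) > 0`, because `h < 0`
and `α` is strictly increasing with `α 0 = 0`. By the mean value theorem `h` increases from a
nonnegative value, a contradiction (`nonneg_of_deriv_pos_of_neg`).

For `ḣ` to be the derivative of `h` along trajectories (`SMCS.IsTrajectory.hasDerivAt`), `h` must
be differentiable, and the main work is the smoothness of `h` (`SMCS.contMDiff_barrier`), that is,
of the orthogonal projection onto the actuated distribution. The latter is spanned by the vectors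
`ηᵢ^♯`, where the `ηᵢ` are local generators of the codistribution (`SMCS.actuated_eq_span`). A
field with values in the span of a smooth frame is smooth if its inner products with the frame are
(`contMDiffAt_of_inner_frame`): its coefficients solve a linear system with the Gram matrix of the
frame, and Cramer's rule applies. This criterion is used twice: with a local frame of `TQ`, for the
smoothness of `ηᵢ^♯` (`contMDiffAt_sharp`), and with the frame `ηᵢ^♯`, for that of `(v - κ)^𝒜`.
-/

namespace GeomCBF

/-! ### Linear systems with smooth coefficients -/

section LinearSystem

variable {E H M ι : Type*} [NormedAddCommGroup E] [NormedSpace ℝ E] [TopologicalSpace H]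
  {I : ModelWithCorners ℝ E H} [TopologicalSpace M] [ChartedSpace H M] {k : WithTop ℕ∞}
  [Fintype ι] [DecidableEq ι] {x : M}

theorem contMDiffAt_det {A : M → Matrix ι ι ℝ}
    (hA : ∀ i j, ContMDiffAt I 𝓘(ℝ, ℝ) k (fun p => A p i j) x) :
    ContMDiffAt I 𝓘(ℝ, ℝ) k (fun p => (A p).det) x := by
  simp only [Matrix.det_apply, Units.smul_def, zsmul_eq_mul]
  exact contMDiffAt_finsetSum fun σ _ =>
    contMDiffAt_const.mul (contMDiffAt_finsetProd fun i _ => hA _ _)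

/-- By Cramer's rule, the solution of a linear system depends smoothly on the system. -/
theorem contMDiffAt_of_mulVec_eq {A : M → Matrix ι ι ℝ} {c r : M → ι → ℝ}
    (hA : ∀ i j, ContMDiffAt I 𝓘(ℝ, ℝ) k (fun p => A p i j) x)
    (hr : ∀ i, ContMDiffAt I 𝓘(ℝ, ℝ) k (fun p => r p i) x)
    (hdet : (A x).det ≠ 0) (h : ∀ᶠ p in 𝓝 x, (A p).mulVec (c p) = r p) (i : ι) :
    ContMDiffAt I 𝓘(ℝ, ℝ) k (fun p => c p i) x := by
  have hd := contMDiffAt_det hA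
  have hcr : ContMDiffAt I 𝓘(ℝ, ℝ) k (fun p => (A p).cramer (r p) i) x := by
    simp only [Matrix.cramer_apply]
    refine contMDiffAt_det fun a b => ?_
    by_cases hb : b = i
    · subst hb
      simpa only [Matrix.updateCol_self] using hr a
    · simpa only [Matrix.updateCol_ne hb] using hA a b
  refine (hcr.div₀ hd hdet).congr_of_eventuallyEq ?_
  filter_upwards [h, hd.continuousAt.eventually_ne hdet] with p hp hp'
  rw [Pi.div_apply, Matrix.cramer_eq_adjugate_mulVec, ← hp, Matrix.mulVec_mulVec, Matrix.adjugate_mul,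
    Matrix.smul_mulVec, Matrix.one_mulVec, Pi.smul_apply, smul_eq_mul, mul_div_cancel_left₀ _ hp']

end LinearSystem

variable {n : ℕ} {Q : Type*} [TopologicalSpace Q] [ChartedSpace (Model n) Q]
  [IsManifold (𝓡 n) ∞ Q]

/-! ### Smooth vector fields along a map -/

section Along

variable {E H M : Type*} [NormedAddCommGroup E] [NormedSpace ℝ E] [TopologicalSpace H]
  {I : ModelWithCorners ℝ E H} [TopologicalSpace M] [ChartedSpace H M] {x : M} {b : M → Q}

theorem contMDiffAt_pairing {η : ∀ p, Cotan n (b p)} {v : ∀ p, Tan n (b p)}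
    (hη : ContMDiffAt I ((𝓡 n).prod 𝓘(ℝ, Model n →L[ℝ] ℝ)) ∞
      (fun p => TotalSpace.mk' (Model n →L[ℝ] ℝ) (E := fun q : Q => Cotan n q) (b p) (η p)) x)
    (hv : ContMDiffAt I (𝓡 n).tangent ∞ (fun p => (⟨b p, v p⟩ : TangentBundle (𝓡 n) Q)) x) :
    ContMDiffAt I 𝓘(ℝ, ℝ) ∞ (fun p => η p (v p)) x := by
  have h : ContMDiffAt I ((𝓡 n).prod 𝓘(ℝ)) ∞
      (fun p => TotalSpace.mk' ℝ (E := Bundle.Trivial Q ℝ) (b p) (η p (v p))) x :=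
    ContMDiffAt.clm_bundle_apply (F₁ := Model n) (E₁ := fun q : Q => Tan n q)
      (E₂ := Bundle.Trivial Q ℝ) hη hv
  simp only [contMDiffAt_totalSpace] at h
  exact h.2

theorem contMDiffAt_inner (g : Metric n Q) {v w : ∀ p, Tan n (b p)}
    (hv : ContMDiffAt I (𝓡 n).tangent ∞ (fun p => (⟨b p, v p⟩ : TangentBundle (𝓡 n) Q)) x)
    (hw : ContMDiffAt I (𝓡 n).tangent ∞ (fun p => (⟨b p, w p⟩ : TangentBundle (𝓡 n) Q)) x) :
    ContMDiffAt I 𝓘(ℝ, ℝ) ∞ (fun p => g.inner (b p) (v p) (w p)) x := by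
  have hb : ContMDiffAt I (𝓡 n) ∞ b x := (contMDiffAt_totalSpace.1 hv).1
  have hg := g.contMDiff.contMDiffAt.comp x hb
  have h : ContMDiffAt I ((𝓡 n).prod 𝓘(ℝ)) ∞
      (fun p => TotalSpace.mk' ℝ (E := Bundle.Trivial Q ℝ) (b p) (g.inner (b p) (v p) (w p))) x :=
    ContMDiffAt.clm_bundle_apply₂ (F₁ := Model n) (F₂ := Model n)
      (E₁ := fun q : Q => Tan n q) (E₂ := fun q : Q => Tan n q)
      (E₃ := Bundle.Trivial Q ℝ) hg hv hw
  simp only [contMDiffAt_totalSpace] at h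
  exact h.2

theorem contMDiffAt_sum_smul {ι : Type*} [Fintype ι] {f : ι → ∀ p, Tan n (b p)}
    {c : M → ι → ℝ} (hb : ContMDiffAt I (𝓡 n) ∞ b x)
    (hf : ∀ i, ContMDiffAt I (𝓡 n).tangent ∞
      (fun p => (⟨b p, f i p⟩ : TangentBundle (𝓡 n) Q)) x)
    (hc : ∀ i, ContMDiffAt I 𝓘(ℝ, ℝ) ∞ (fun p => c p i) x) :
    ContMDiffAt I (𝓡 n).tangent ∞
      (fun p => (⟨b p, ∑ i, c p i • f i p⟩ : TangentBundle (𝓡 n) Q)) x := by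
  refine contMDiffAt_totalSpace.2 ⟨hb, ?_⟩
  let e := trivializationAt (Model n) (fun q : Q => Tan n q) (b x)
  have h : ContMDiffAt I 𝓘(ℝ, Model n) ∞
      (fun p => ∑ i, c p i • (e (⟨b p, f i p⟩ : TangentBundle (𝓡 n) Q)).2) x :=
    contMDiffAt_finsetSum fun i _ => (hc i).smul (contMDiffAt_totalSpace.1 (hf i)).2
  refine h.congr_of_eventuallyEq ?_
  filter_upwards [hb.continuousAt (e.open_baseSet.mem_nhds (mem_baseSet_trivializationAt _ _ _))]
    with p hp
  have key : ∀ u : Tan n (b p),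
      (e (⟨b p, u⟩ : TangentBundle (𝓡 n) Q)).2 = e.linearMapAt ℝ (b p) u := fun u => by
    rw [e.coe_linearMapAt_of_mem hp]
  refine (key _).trans ((map_sum _ _ _).trans (Finset.sum_congr rfl fun i _ => ?_))
  exact (map_smul _ _ _).trans (congrArg _ (key _).symm)

/-- The Gram determinant of linearly independent vectors does not vanish. -/
theorem det_gram_ne_zero (g : Metric n Q) (q : Q) {ι : Type*} [Fintype ι] [DecidableEq ι]
    {f : ι → Tan n q} (hf : LinearIndependent ℝ f) :
    (Matrix.of fun j i => g.inner q (f i) (f j)).det ≠ 0 := by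
  intro h
  obtain ⟨c, hc, hc'⟩ := Matrix.exists_mulVec_eq_zero_iff.2 h
  have h0 : ∀ j, g.inner q (∑ i, c i • f i) (f j) = 0 := fun j => by
    simpa [Matrix.mulVec, dotProduct, mul_comm] using congrFun hc' j
  have h1 : g.inner q (∑ i, c i • f i) (∑ i, c i • f i) = 0 := by
    rw [map_sum]
    exact Finset.sum_eq_zero fun j _ => by rw [map_smul, h0, smul_zero]
  have h2 : ∑ i, c i • f i = 0 := by
    by_contra h3
    exact (g.pos q _ h3).ne' h1
  exact hc (funext (Fintype.linearIndependent_iff.1 hf c h2))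

/-- A vector field along a map that takes its values in the span of a smooth frame is smooth as
soon as its inner products with the frame are: its coefficients solve the linear system given by
the Gram matrix of the frame. -/
theorem contMDiffAt_of_inner_frame (g : Metric n Q) {ι : Type*} [Fintype ι]
    {f : ι → ∀ p, Tan n (b p)} {v : ∀ p, Tan n (b p)} (hb : ContMDiffAt I (𝓡 n) ∞ b x)
    (hf : ∀ i, ContMDiffAt I (𝓡 n).tangent ∞
      (fun p => (⟨b p, f i p⟩ : TangentBundle (𝓡 n) Q)) x)
    (hli : LinearIndependent ℝ fun i => f i x)
    (hspan : ∀ᶠ p in 𝓝 x, v p ∈ Submodule.span ℝ (range fun i => f i p))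
    (hv : ∀ j, ContMDiffAt I 𝓘(ℝ, ℝ) ∞ (fun p => g.inner (b p) (v p) (f j p)) x) :
    ContMDiffAt I (𝓡 n).tangent ∞ (fun p => (⟨b p, v p⟩ : TangentBundle (𝓡 n) Q)) x := by
  classical
  have hex : ∀ p, ∃ c : ι → ℝ, v p ∈ Submodule.span ℝ (range fun i => f i p) →
      ∑ i, c i • f i p = v p := fun p => by
    by_cases h : v p ∈ Submodule.span ℝ (range fun i => f i p)
    · obtain ⟨c, hc⟩ := (Submodule.mem_span_range_iff_exists_fun ℝ).1 h
      exact ⟨c, fun _ => hc⟩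
    · exact ⟨0, fun h' => absurd h' h⟩
  choose c hc using hex
  have hcs := contMDiffAt_of_mulVec_eq (c := c)
    (A := fun p => Matrix.of fun j i => g.inner (b p) (f i p) (f j p))
    (r := fun p j => g.inner (b p) (v p) (f j p))
    (fun j i => contMDiffAt_inner g (hf i) (hf j)) hv (det_gram_ne_zero g (b x) hli) <| by
      filter_upwards [hspan] with p hp
      funext j
      conv_rhs => rw [← hc p hp]
      simp [Matrix.mulVec, dotProduct, mul_comm]
  refine (contMDiffAt_sum_smul hb hf hcs).congr_of_eventuallyEq ?_
  filter_upwards [hspan] with p hp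
  rw [hc p hp]

/-- The index raising of a smooth covector field along a map is smooth. -/
theorem contMDiffAt_sharp (g : Metric n Q) {η : ∀ p, Cotan n (b p)}
    (hη : ContMDiffAt I ((𝓡 n).prod 𝓘(ℝ, Model n →L[ℝ] ℝ)) ∞
      (fun p => TotalSpace.mk' (Model n →L[ℝ] ℝ) (E := fun q : Q => Cotan n q) (b p) (η p)) x) :
    ContMDiffAt I (𝓡 n).tangent ∞
      (fun p => (⟨b p, sharp g (b p) (η p)⟩ : TangentBundle (𝓡 n) Q)) x := by
  have hb : ContMDiffAt I (𝓡 n) ∞ b x := (contMDiffAt_totalSpace.1 hη).1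
  let e := trivializationAt (Model n) (fun q : Q => Tan n q) (b x)
  let B := Module.finBasis ℝ (Model n)
  have hfr := e.isLocalFrameOn_localFrame_baseSet (𝓡 n) ∞ B
  have hx : b x ∈ e.baseSet := mem_baseSet_trivializationAt _ _ _
  have hf : ∀ i, ContMDiffAt I (𝓡 n).tangent ∞
      (fun p => (⟨b p, e.localFrame B i (b p)⟩ : TangentBundle (𝓡 n) Q)) x := fun i =>
    (hfr.contMDiffAt e.open_baseSet hx i).comp x hb
  refine contMDiffAt_of_inner_frame g hb hf (hfr.linearIndependent hx) ?_ fun j => ?_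
  · filter_upwards [hb.continuousAt (e.open_baseSet.mem_nhds hx)] with p hp
    exact hfr.generating hp trivial
  · simp only [inner_sharp]
    exact contMDiffAt_pairing hη (hf j)

end Along

theorem linearIndependent_sharp (g : Metric n Q) (q : Q) {ι : Type*} [Fintype ι]
    {η : ι → Cotan n q} (hη : LinearIndependent ℝ η) :
    LinearIndependent ℝ fun i => sharp g q (η i) := by
  rw [Fintype.linearIndependent_iff] at hη ⊢
  intro c hc
  refine hη c (ContinuousLinearMap.ext fun v => ?_)
  have h := congrArg (fun u => g.inner q u v) hc
  simpa [inner_sharp] using h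

namespace SMCS

variable {m : ℕ} (S : SMCS n m Q)

/-! ### Smoothness of the barrier function -/

theorem apply_actuatedProj {q : Q} {φ : Cotan n q} (hφ : φ ∈ S.𝓕 q) (v : Tan n q) :
    φ (S.actuatedProj q v) = φ v := by
  have h : S.actuatedProj q v - v ∈ S.unactuated q := by
    have := Submodule.sub_projection_mem (S.isCompl_actuated_unactuated q) v
    rw [← neg_sub]
    exact neg_mem this
  rw [← sub_eq_zero, ← map_sub]
  exact h φ hφ


/-- The actuated distribution is the index raising of the input codistribution. -/
theorem actuated_eq_span {q : Q} {ι : Type*} [Finite ι] {η : ι → Cotan n q}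
    (hη : Submodule.span ℝ (range η) = S.𝓕 q) :
    S.actuated q = Submodule.span ℝ (range fun i => sharp S.g q (η i)) := by
  set B := metricForm S.g q
  set W := Submodule.span ℝ (range fun i => sharp S.g q (η i)) with hW
  have hU : B.orthogonal W = S.unactuated q := by
    ext v
    rw [LinearMap.BilinForm.mem_orthogonal_iff]
    constructor
    · intro h φ hφ
      rw [← hη] at hφ
      induction hφ using Submodule.span_induction with
      | mem φ hφ =>
        obtain ⟨i, rfl⟩ := hφ
        exact (inner_sharp S.g q (η i) v).symm.trans (h _ (Submodule.subset_span ⟨i, rfl⟩))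
      | zero => rfl
      | add φ ψ _ _ h₁ h₂ => rw [_root_.add_apply, h₁, h₂, add_zero]
      | smul c φ _ h₁ => rw [_root_.smul_apply, h₁, smul_zero]
    · intro h w hw
      change B w v = 0
      induction hw using Submodule.span_induction with
      | mem w hw =>
        obtain ⟨i, rfl⟩ := hw
        exact (inner_sharp S.g q (η i) v).trans (h _ (hη ▸ Submodule.subset_span ⟨i, rfl⟩))
      | zero => simp
      | add w w' _ _ h₁ h₂ => rw [map_add, LinearMap.add_apply, h₁, h₂, add_zero]
      | smul c w _ h₁ => rw [map_smul, LinearMap.smul_apply, h₁, smul_zero]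
  rw [actuated, ← hU]
  exact LinearMap.BilinForm.orthogonal_orthogonal (metricForm_nondegenerate S.g q)
    (metricForm_isSymm S.g q).isRefl W

/-- The barrier function is smooth: the actuated part of `v - κ` lies in the span of the raised
local generators `ηᵢ^♯` of the codistribution, and its inner product with `ηᵢ^♯` is
`ηᵢ (v - κ)`. -/
theorem contMDiff_barrier {h₀ : Q → ℝ} (hh₀ : ContMDiff (𝓡 n) 𝓘(ℝ, ℝ) ∞ h₀)
    {κ : ∀ q : Q, Tan n q}
    (hκ : ContMDiff (𝓡 n) (𝓡 n).tangent ∞ (fun q => (⟨q, κ q⟩ : TangentBundle (𝓡 n) Q)))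
    (ε : ℝ) : ContMDiff (𝓡 n).tangent 𝓘(ℝ, ℝ) ∞ (S.barrier h₀ κ ε) := by
  intro v
  obtain ⟨U, hUo, hvU, η, hηs, hη⟩ := S.isCodistribution v.proj
  have hπ : ContMDiffAt (𝓡 n).tangent (𝓡 n) ∞
      (TotalSpace.proj : TangentBundle (𝓡 n) Q → Q) v := contMDiffAt_proj (fun q : Q => Tan n q)
  have hηπ : ∀ i, ContMDiffAt (𝓡 n).tangent ((𝓡 n).prod 𝓘(ℝ, Model n →L[ℝ] ℝ)) ∞
      (fun w : TangentBundle (𝓡 n) Q => TotalSpace.mk' (Model n →L[ℝ] ℝ)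
        (E := fun q : Q => Cotan n q) w.proj (η i w.proj)) v := fun i =>
    ContMDiffAt.comp v ((hηs i).contMDiffAt (hUo.mem_nhds hvU)) hπ
  have hproj : ContMDiffAt (𝓡 n).tangent (𝓡 n).tangent ∞
      (fun w : TangentBundle (𝓡 n) Q =>
        (⟨w.proj, S.actuatedProj w.proj (w.snd - κ w.proj)⟩ : TangentBundle (𝓡 n) Q)) v := by
    have hU : ∀ᶠ w : TangentBundle (𝓡 n) Q in 𝓝 v, w.proj ∈ U :=
      hπ.continuousAt (hUo.mem_nhds hvU)
    have hsharp : ∀ i, ContMDiffAt (𝓡 n).tangent (𝓡 n).tangent ∞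
        (fun w : TangentBundle (𝓡 n) Q =>
          (⟨w.proj, sharp S.g w.proj (η i w.proj)⟩ : TangentBundle (𝓡 n) Q)) v := fun i =>
      contMDiffAt_sharp (b := fun w : TangentBundle (𝓡 n) Q => w.proj)
        (η := fun w => η i w.proj) S.g (hηπ i)
    refine contMDiffAt_of_inner_frame (b := fun w : TangentBundle (𝓡 n) Q => w.proj)
      (f := fun i w => sharp S.g w.proj (η i w.proj))
      (v := fun w => S.actuatedProj w.proj (w.snd - κ w.proj)) S.g hπ hsharp ?_ ?_ fun j => ?_
    · exact linearIndependent_sharp S.g v.proj (hη _ hvU).1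
    · filter_upwards [hU] with w hw
      rw [← S.actuated_eq_span (hη _ hw).2]
      exact Submodule.projection_apply_mem _ _
    · have hs : ContMDiffAt (𝓡 n).tangent 𝓘(ℝ, ℝ) ∞
          (fun w : TangentBundle (𝓡 n) Q => η j w.proj w.snd) v :=
        contMDiffAt_pairing (b := fun w : TangentBundle (𝓡 n) Q => w.proj)
          (η := fun w => η j w.proj) (v := fun w => w.snd) (hηπ j) contMDiffAt_id
      have hκs : ContMDiffAt (𝓡 n).tangent 𝓘(ℝ, ℝ) ∞
          (fun w : TangentBundle (𝓡 n) Q => η j w.proj (κ w.proj)) v :=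
        contMDiffAt_pairing (b := fun w : TangentBundle (𝓡 n) Q => w.proj)
          (η := fun w => η j w.proj) (v := fun w => κ w.proj) (hηπ j) (hκ.contMDiffAt.comp v hπ)
      refine (hs.sub hκs).congr_of_eventuallyEq ?_
      filter_upwards [hU] with w hw
      rw [S.g.symm, inner_sharp,
        S.apply_actuatedProj ((hη _ hw).2 ▸ Submodule.subset_span ⟨j, rfl⟩), map_sub]
  exact (hh₀.contMDiffAt.comp v hπ).sub (contMDiffAt_const.mul (contMDiffAt_inner S.g hproj hproj))

theorem barrier_le (h₀ : Q → ℝ) (κ : ∀ q : Q, Tan n q) {ε : ℝ} (hε : 0 ≤ ε)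
    (v : TangentBundle (𝓡 n) Q) : S.barrier h₀ κ ε v ≤ h₀ v.proj := by
  have h : ∀ e : Tan n v.proj, 0 ≤ S.g.inner v.proj e e := fun e => by
    by_cases he : e = 0
    · simp [he]
    · exact (S.g.pos _ e he).le
  exact sub_le_self _ (mul_nonneg (by positivity) (h _))

/-- The derivative of a smooth function `h` along a trajectory is `ḣ`. -/
theorem IsTrajectory.hasDerivAt {F : ∀ v : TangentBundle (𝓡 n) Q, Cotan n v.proj}
    {v₀ : TangentBundle (𝓡 n) Q} {J : Set ℝ} {γ : ℝ → TangentBundle (𝓡 n) Q}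
    {S : SMCS n m Q} (hγ : S.IsTrajectory F v₀ J γ) {h : TangentBundle (𝓡 n) Q → ℝ}
    (hh : ContMDiff (𝓡 n).tangent 𝓘(ℝ, ℝ) ∞ h) {t : ℝ} (ht : t ∈ J) :
    HasDerivAt (fun s => h (γ s)) (S.hDot h (γ t) (F (γ t))) t := by
  have h1 := (hγ.isMIntegralCurveOn t ht).hasMFDerivAt (hγ.isOpen.mem_nhds ht)
  have h2 := ((hh.mdifferentiable (by simp)) (γ t)).hasMFDerivAt.comp t h1
  have h3 : HasFDerivAt (fun s => h (γ s)) ((mvfderiv (𝓡 n).tangent h (γ t)).comp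
      ((1 : ℝ →L[ℝ] ℝ).smulRight (S.dynamics (γ t) (F (γ t))))) t :=
    hasMFDerivAt_iff_hasFDerivAt.1 h2
  refine h3.hasDerivAt.congr_deriv ?_
  simp [hDot]

end SMCS

/-! ### The comparison argument -/

/-- A function that starts nonnegative remains so if, shortly after each time at which it is
nonnegative, its derivative is positive wherever the function itself is negative. -/
theorem nonneg_of_deriv_pos_of_neg {w w' : ℝ → ℝ} {a b : ℝ} (hab : a ≤ b)
    (hw : ∀ t ∈ Icc a b, HasDerivAt w (w' t) t) (ha : 0 ≤ w a)
    (hpos : ∀ s ∈ Icc a b, 0 ≤ w s → ∀ᶠ t in 𝓝[>] s, t ∈ Icc a b → w t < 0 → 0 < w' t) :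
    0 ≤ w b := by
  have hcont : ContinuousOn w (Icc a b) := fun t ht => (hw t ht).continuousAt.continuousWithinAt
  have hclosed : IsClosed ({t | 0 ≤ w t} ∩ Icc a b) := by
    rw [inter_comm]
    exact hcont.preimage_isClosed_of_isClosed isClosed_Icc isClosed_Ici
  refine hclosed.Icc_subset_of_forall_exists_gt ha ?_ (right_mem_Icc.2 hab)
  rintro s ⟨hs0, hs⟩ y hy
  by_contra hempty
  have hneg : ∀ t ∈ Ioc s y, w t < 0 := fun t ht => by
    by_contra h
    exact hempty ⟨t, not_lt.1 h, ht⟩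
  obtain ⟨u, hu, hu'⟩ := mem_nhdsGT_iff_exists_Ioo_subset.1
    (hpos s (Ico_subset_Icc_self hs) hs0)
  obtain ⟨t, hst, ht⟩ := exists_between (lt_min (lt_min hu hy) hs.2)
  simp only [lt_min_iff] at ht
  have hsub : ∀ {r}, r ∈ Icc s t → r ∈ Icc a b := fun hr =>
    ⟨hs.1.trans hr.1, hr.2.trans ht.2.le⟩
  obtain ⟨c, hc, hc'⟩ := exists_hasDerivAt_eq_slope w w' hst
    (hcont.mono fun r hr => hsub hr) fun r hr => hw r (hsub (Ioo_subset_Icc_self hr))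
  have h1 : 0 < w' c := hu' ⟨hc.1, hc.2.trans ht.1.1⟩ (hsub (Ioo_subset_Icc_self hc))
    (hneg c ⟨hc.1, (hc.2.trans ht.1.2).le⟩)
  have h2 : w' c * (t - s) = w t - w s := by
    rw [hc', div_mul_cancel₀ _ (sub_pos.2 hst).ne']
  linarith [mul_pos h1 (sub_pos.2 hst), hs0.out, hneg t ⟨hst, ht.1.2.le⟩]

end GeomCBF

theorem mainTheorem6 {n m : ℕ} {Q : Type*} [TopologicalSpace Q] [T2Space Q]
    [SecondCountableTopology Q] [ChartedSpace (GeomCBF.Model n) Q] [IsManifold (𝓡 n) ∞ Q]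
    (S : GeomCBF.SMCS n m Q)
    (h₀ : Q → ℝ) (hh₀ : ContMDiff (𝓡 n) 𝓘(ℝ, ℝ) ∞ h₀)
    (hreg : ∀ q, h₀ q = 0 → Function.Surjective (mvfderiv (𝓡 n) h₀ q))
    (α : ℝ → ℝ) (hα : GeomCBF.IsExtendedClassKInfty α) (hα_lip : LocallyLipschitz α)
    (D₀ : Set Q) (hD₀ : IsOpen D₀) (hCD₀ : {q | 0 ≤ h₀ q} ⊆ D₀)
    (κ : ∀ q : Q, TangentSpace (𝓡 n) q)
    (hκ : ContMDiff (𝓡 n) (𝓡 n).tangent ∞ (fun q => (⟨q, κ q⟩ : TangentBundle (𝓡 n) Q)))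
    (hκ_safe : ∀ q ∈ D₀, mvfderiv (𝓡 n) h₀ q (κ q) > -α (h₀ q))
    (hunact : ∀ q ∈ D₀, ∀ u ∈ S.unactuated q, mvfderiv (𝓡 n) h₀ q u = 0)
    (ε : ℝ) (hε : 0 < ε)
    (F : ∀ v : TangentBundle (𝓡 n) Q, TangentSpace (𝓡 n) v.proj →L[ℝ] ℝ)
    (hF : S.IsControlForce F)
    (hF_safe : ∀ v : TangentBundle (𝓡 n) Q, v.proj ∈ D₀ →
      S.hDot (S.barrier h₀ κ ε) v (F v) ≥ -α (S.barrier h₀ κ ε v))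
    (v₀ : TangentBundle (𝓡 n) Q) (hv₀ : 0 ≤ S.barrier h₀ κ ε v₀)
    (J : Set ℝ) (γ : ℝ → TangentBundle (𝓡 n) Q) (hγ : S.IsTrajectory F v₀ J γ) :
    ∀ t ∈ J, 0 ≤ t → 0 ≤ h₀ (γ t).proj := by
  intro t ht ht0
  have hJ : Icc 0 t ⊆ J := hγ.ordConnected.out hγ.zero_mem ht
  have hcont : ∀ s ∈ J, ContinuousAt γ s := fun s hs =>
    ((hγ.isMIntegralCurveOn s hs).hasMFDerivAt (hγ.isOpen.mem_nhds hs)).continuousAt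
  refine le_trans ?_ (S.barrier_le h₀ κ hε.le (γ t))
  refine GeomCBF.nonneg_of_deriv_pos_of_neg (w := fun s => S.barrier h₀ κ ε (γ s)) ht0
    (fun s hs => hγ.hasDerivAt (S.contMDiff_barrier hh₀ hκ ε) (hJ hs)) (by rwa [hγ.initial])
    fun s hs hs0 => ?_
  -- The barrier condition is only assumed over `D₀`, an open set that contains `C₀`.
  have hD : (γ s).proj ∈ D₀ := hCD₀ (hs0.trans (S.barrier_le h₀ κ hε.le (γ s)))
  have hD' : ∀ᶠ r in 𝓝 s, (γ r).proj ∈ D₀ :=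
    ((FiberBundle.continuous_proj (GeomCBF.Model n)
      (fun q : Q => TangentSpace (𝓡 n) q)).continuousAt.comp (hcont s (hJ hs)))
      (hD₀.mem_nhds hD)
  filter_upwards [nhdsWithin_le_nhds hD'] with r hr _ hneg
  have hα' := hα.strictMono hneg
  rw [hα.map_zero] at hα'
  exact (neg_pos.2 hα').trans_le (hF_safe (γ r) hr)
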